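/- Let $\Sigma$ be a closed connected oriented surface of genus $g\ge 2$ (so $\chi(\Sigma)=2-2g$). A triangulation $\mathcal T$ of $\Sigma$ is a finite set of vertices together with embedded arcs or loops (edges) joining vertices and meeting only at endpoints, such that each complementary region (face) is a disk bounded by three edges and every vertex has valence at least $3$; loops (which count twice in the valence) and parallel edges are allowed. Triangulations are regarded as combinatorial data: the finite set of oriented edges, with the reversal $d\mapsto \bar d$ and the map sending $d$ to the next oriented edge on the boundary of the face to its left; in these terms the genus is given by $v-e+f=2-2g$, where $v,e,f$ are the numbers of vertices, edges and faces. $\mathcal T$ is simplicial if its $1$-skeleton has no loops and no parallel edges, and quasi-simplicial if there is a finite covering $\hat\Sigma\to\Sigma$ such that the lift of $\mathcal T$ to $\hat\Sigma$ is simplicial. A decoration of $\mathcal T$ consists of a partition of the vertices into blue and white ones and of an orientation of each edge in some set of edges whose endpoints are both blue. A corner is a path $(\epsilon_1,\alpha,\epsilon_2)$ in the boundary of a triangle. Its inversion is $1$ if $\alpha$ is blue and either neither of $\epsilon_1,\epsilon_2$ is oriented by the decoration, or both are and, along the path, one of them points into $\alpha$ and the other one out of $\alpha$; it is $1/2$ if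 exactly one of $\epsilon_1,\epsilon_2$ is oriented; it is $0$ otherwise. The total inversion $\mathfrak w(\alpha)$ is the sum of the inversions of all corners of triangles at $\alpha$. The decoration is tight if $\mathfrak w(\alpha)\le 2$ for every blue vertex $\alpha$, and trivial if all vertices are white (so that no edge is oriented). Proposition. Let $\mathcal T$ be a quasi-simplicial triangulation of a closed connected oriented surface of genus at least $2$. Then a decoration of $\mathcal T$ is tight if and only if it is the trivial one. -/

import Mathlib

universe u

/-- A closed oriented cellulated surface as combinatorial data (a combinatorial map).
`D` is the set of oriented edges. `rev` reverses the orientation of an oriented edge, and `next d`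
is the oriented edge that follows `d` on the boundary of the face lying to the left of `d`. -/
structure OrientedMap (D : Type u) where
  /-- reversal of oriented edges -/
  rev : Equiv.Perm D
  /-- successor of an oriented edge along the boundary of the face on its left -/
  next : Equiv.Perm D
  rev_rev : ∀ d, rev (rev d) = d
  rev_ne : ∀ d, rev d ≠ d

namespace OrientedMap

variable {D : Type u} (M : OrientedMap D)

/-- The rotation around vertices: `rot d` is the oriented edge with the same initial point as `d`
that follows `d` counterclockwise, i.e. the reverse of the oriented edge preceding `d` on the
boundary of the face to the left of `d`. -/
def rot : Equiv.Perm D := M.rev * M.next⁻¹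

/-- Vertices are the cycles of the rotation. -/
def Vertex : Type u := Quotient (Equiv.Perm.SameCycle.setoid M.rot)

/-- Unoriented edges are the pairs `{d, rev d}`. -/
def Edge : Type u := Quotient (Equiv.Perm.SameCycle.setoid M.rev)

/-- Faces are the cycles of `next`. -/
def Face : Type u := Quotient (Equiv.Perm.SameCycle.setoid M.next)

/-- The initial point of an oriented edge. -/
def tail (d : D) : M.Vertex := Quotient.mk (Equiv.Perm.SameCycle.setoid M.rot) d

/-- The terminus of an oriented edge. -/
def head (d : D) : M.Vertex := M.tail (M.rev d)

/-- The valence of a vertex: the number of oriented edges issuing from it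
(so a loop counts twice). -/
noncomputable def valence (v : M.Vertex) : ℕ := Nat.card {d : D // M.tail d = v}

/-- `v - e + f`. -/
noncomputable def eulerChar : ℤ :=
  (Nat.card M.Vertex : ℤ) - (Nat.card M.Edge : ℤ) + (Nat.card M.Face : ℤ)

end OrientedMap

/-- A triangulation of a closed connected oriented surface, as combinatorial data, with set of
oriented edges `D`. Loops and parallel edges are allowed; every face is bounded by
three edges and every vertex has valence at least three. -/
structure Triangulation (D : Type u) [Fintype D] extends OrientedMap D where
  nonempty : Nonempty D
  connected : ∀ d d' : D, ∃ g ∈ Subgroup.closure {rev, next}, g d = d'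
  next_next_next : ∀ d, next (next (next d)) = d
  next_ne : ∀ d, next d ≠ d
  three_le_valence : ∀ v : toOrientedMap.Vertex, 3 ≤ toOrientedMap.valence v

namespace Triangulation

variable {D : Type u} [Fintype D] (T : Triangulation D)

/-- The triangulated surface has genus `g`: its Euler characteristic `v - e + f` is `2 - 2g`. -/
def HasGenus (g : ℕ) : Prop := T.eulerChar = 2 - 2 * (g : ℤ)

/-- A triangulation is simplicial if its `1`-skeleton has neither loops nor parallel edges:
no edge has equal endpoints, and an oriented edge is determined by its initial point and its
terminus. (As all valences are at least three, this says that the closed star of every vertex is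
an embedded disk.) -/
def IsSimplicial : Prop :=
  (∀ d, T.tail d ≠ T.head d) ∧
    ∀ d d', T.tail d = T.tail d' → T.head d = T.head d' → d = d'

/-- `f` exhibits `T'` as the lift of `T` to a covering of the surface: it maps oriented
edges onto oriented edges, respects reversal and faces, and restricts to a bijection from the
oriented edges issuing from each vertex to those issuing from its image (no branching). -/
structure IsCovering {D' : Type u} [Fintype D'] (T' : Triangulation D') (T : Triangulation D)
    (f : D' → D) : Prop where
  surjective : Function.Surjective f
  map_rev : ∀ d, f (T'.rev d) = T.rev (f d)
  map_next : ∀ d, f (T'.next d) = T.next (f d)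
  bijOn_star : ∀ a, Set.BijOn f {d | T'.tail d = T'.tail a} {d | T.tail d = T.tail (f a)}

/-- A triangulation is quasi-simplicial if its lift to some finite covering of the surface is
simplicial. -/
def IsQuasiSimplicial : Prop :=
  ∃ (D' : Type u) (_ : Fintype D') (T' : Triangulation D') (f : D' → D),
    IsCovering T' T f ∧ T'.IsSimplicial

/-- A decoration: a colouring of the vertices in blue and white (the vertices not in `blue` are
white), and an orientation of some of the edges with both endpoints blue. An oriented edge `d`
belongs to `arrows` if its underlying edge is among the edges that are given an orientation and
the chosen orientation is that of `d`. -/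
@[ext]
structure Decoration where
  blue : Set T.Vertex
  arrows : Set D
  rev_notMem : ∀ d ∈ arrows, T.rev d ∉ arrows
  blue_of_mem : ∀ d ∈ arrows, T.tail d ∈ blue ∧ T.head d ∈ blue

namespace Decoration

/-- The trivial decoration: all vertices are white. -/
def trivial : Decoration T where
  blue := ∅
  arrows := ∅
  rev_notMem := fun _ h => h.elim
  blue_of_mem := fun _ h => h.elim

variable {T} (δ : Decoration T)

/-- The edge underlying `d` is given an orientation by the decoration. -/
def EdgeOriented (d : D) : Prop := d ∈ δ.arrows ∨ T.rev d ∈ δ.arrows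

open Classical in
/-- The inversion of a corner. The corners of the triangles are indexed by the oriented edges: the
corner of `d` is the path `(e, tail d, d)` on the boundary of the triangle to the left of `d`, where
`e` is the oriented edge preceding `d` on this boundary. The vertex of the corner is the initial
point of one of the two edges and the terminus of the other one, along this path, precisely if both
chosen orientations agree with the path or both disagree with it. -/
noncomputable def inversion (d : D) : ℚ :=
  let e := T.next.symm d
  if T.tail d ∈ δ.blue ∧
      ((¬ δ.EdgeOriented e ∧ ¬ δ.EdgeOriented d) ∨
        (e ∈ δ.arrows ∧ d ∈ δ.arrows) ∨ (T.rev e ∈ δ.arrows ∧ T.rev d ∈ δ.arrows)) then 1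
  else if (δ.EdgeOriented e ∧ ¬ δ.EdgeOriented d) ∨ (¬ δ.EdgeOriented e ∧ δ.EdgeOriented d) then 1 / 2
  else 0

open Classical in
/-- The total inversion around a vertex: the sum of the inversions of the corners there. -/
noncomputable def totalInversion (v : T.Vertex) : ℚ :=
  ∑ d : D with T.tail d = v, δ.inversion d

/-- A decoration is tight if the total inversion around each blue vertex is at most `2`. -/
def IsTight : Prop := ∀ v ∈ δ.blue, δ.totalInversion v ≤ 2

end Decoration

end Triangulation

/-! The trivial decoration is tight because there is no blue vertex to test. Conversely, a tight
decoration lifts to a tight one on the simplicial cover, and `6V < D` (that is, negative Euler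
characteristic) lifts too. So it suffices to treat a simplicial triangulation.

There the inversions in a triangle with a blue vertex add up to at least 1, so tightness allows at
most `2|B|` triangles to touch the blue set `B` (`IsTight.card_touching_le`). But every nonempty `B`
touches more than `2|B|` triangles (`IsSimplicial.six_mul_card_lt`). Triangles are counted by their
oriented edges, whence 6 for 2.

For this, take `B` connected, since pieces not joined by edges touch disjoint sets of triangles.
Induct on the size of the complement, starting from `6V < D`. If all triangles at some outside
neighbour of `B` touch `B`, adding that neighbour to `B` touches no new triangle. Otherwise the
opposite sides of triangles with just one vertex in `B` form a walk without backtracking, so there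
are at least three of them, and an Euler count with `χ(B) ≤ 1` concludes. -/

/-! ### Counting in combinatorial maps. -/

open Classical in
/-- If every fibre of `q` has `k` elements, then so many times more points lie over a subset. -/
theorem mul_card_filter_eq_card_filter_comp {α β : Type*} [Fintype α] [Fintype β] (q : α → β)
    (k : ℕ) (hk : ∀ a, Finset.card {x | q x = q a} = k) (hq : Function.Surjective q)
    (P : β → Prop) : k * Finset.card {b | P b} = Finset.card {a | P (q a)} := by
  rw [Finset.card_eq_sum_card_fiberwise (f := q) (s := {a | P (q a)}) (t := {b | P b})
    (fun a ha => by simpa using ha), Finset.sum_const_nat (m := k), mul_comm]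
  intro b hb
  obtain ⟨a, rfl⟩ := hq b
  rw [← hk a, Finset.filter_filter]
  congr 1
  ext x
  simp only [Finset.mem_filter, Finset.mem_univ, true_and] at hb ⊢
  exact ⟨fun h => h.2, fun h => ⟨h ▸ hb, h⟩⟩

/-- Finiteness makes nonnegative powers reach the whole cycle, so forward closure is enough. -/
theorem Equiv.Perm.SameCycle.induction_on {α : Type*} [Finite α] {σ : Equiv.Perm α}
    {p : α → Prop} {a b : α} (hab : σ.SameCycle a b) (ha : p a) (h : ∀ x, p x → p (σ x)) : p b := by
  obtain ⟨i, rfl⟩ := hab.exists_nat_pow_eq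
  clear hab
  induction i with
  | zero => exact ha
  | succ i ih => rw [pow_succ', Equiv.Perm.mul_apply]; exact h _ ih

namespace OrientedMap

variable {D : Type u} (M : OrientedMap D)

/-- The unoriented edge underlying an oriented edge. -/
def edge (d : D) : M.Edge := Quotient.mk (Equiv.Perm.SameCycle.setoid M.rev) d

/-- The face to the left of an oriented edge. -/
def face (d : D) : M.Face := Quotient.mk (Equiv.Perm.SameCycle.setoid M.next) d

instance [Finite D] : Finite M.Vertex := Quotient.finite _
instance [Finite D] : Finite M.Edge := Quotient.finite _
instance [Finite D] : Finite M.Face := Quotient.finite _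
noncomputable instance [Finite D] : Fintype M.Vertex := Fintype.ofFinite _
noncomputable instance [Finite D] : Fintype M.Edge := Fintype.ofFinite _
noncomputable instance [Finite D] : Fintype M.Face := Fintype.ofFinite _

theorem tail_surjective : Function.Surjective M.tail := Quotient.mk_surjective
theorem edge_surjective : Function.Surjective M.edge := Quotient.mk_surjective
theorem face_surjective : Function.Surjective M.face := Quotient.mk_surjective

variable {M}

theorem tail_eq_tail_iff {a b : D} : M.tail a = M.tail b ↔ M.rot.SameCycle a b := Quotient.eq
theorem edge_eq_edge_iff {a b : D} : M.edge a = M.edge b ↔ M.rev.SameCycle a b := Quotient.eq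
theorem face_eq_face_iff {a b : D} : M.face a = M.face b ↔ M.next.SameCycle a b := Quotient.eq

theorem tail_rot (d : D) : M.tail (M.rot d) = M.tail d :=
  tail_eq_tail_iff.2 (Equiv.Perm.sameCycle_apply_left.2 (Equiv.Perm.SameCycle.refl _ _))

theorem face_next (d : D) : M.face (M.next d) = M.face d :=
  face_eq_face_iff.2 (Equiv.Perm.sameCycle_apply_left.2 (Equiv.Perm.SameCycle.refl _ _))

theorem edge_rev (d : D) : M.edge (M.rev d) = M.edge d :=
  edge_eq_edge_iff.2 (Equiv.Perm.sameCycle_apply_left.2 (Equiv.Perm.SameCycle.refl _ _))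

theorem rot_next (d : D) : M.rot (M.next d) = M.rev d := by simp [rot]

theorem tail_rev (d : D) : M.tail (M.rev d) = M.tail (M.next d) := by
  rw [← rot_next, tail_rot]

theorem tail_next_rev (d : D) : M.tail (M.next (M.rev d)) = M.tail d := by
  rw [← tail_rev, M.rev_rev]

theorem edge_eq_edge_iff_or [Finite D] {a b : D} : M.edge b = M.edge a ↔ b = a ∨ b = M.rev a := by
  constructor
  · intro h
    refine (edge_eq_edge_iff.1 h.symm).induction_on (p := fun b => b = a ∨ b = M.rev a)
      (Or.inl rfl) ?_
    rintro x (rfl | rfl)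
    · exact Or.inr rfl
    · exact Or.inl (M.rev_rev _)
  · rintro (rfl | rfl)
    · rfl
    · exact edge_rev a

open Classical in
theorem card_edge_fiber [Fintype D] (a : D) : Finset.card {x | M.edge x = M.edge a} = 2 := by
  have : ({x | M.edge x = M.edge a} : Finset D) = {a, M.rev a} := by
    ext x; simp [edge_eq_edge_iff_or]
  rw [this, Finset.card_pair (M.rev_ne a).symm]

end OrientedMap

namespace Triangulation

variable {D : Type u} [Fintype D] {T : Triangulation D}

open OrientedMap

theorem face_eq_face_iff_or {a b : D} :
    T.face b = T.face a ↔ b = a ∨ b = T.next a ∨ b = T.next (T.next a) := by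
  constructor
  · intro h
    refine (face_eq_face_iff.1 h.symm).induction_on
      (p := fun b => b = a ∨ b = T.next a ∨ b = T.next (T.next a)) (Or.inl rfl) ?_
    rintro x (rfl | rfl | rfl)
    · exact Or.inr (Or.inl rfl)
    · exact Or.inr (Or.inr rfl)
    · exact Or.inl (T.next_next_next _)
  · rintro (rfl | rfl | rfl)
    · rfl
    · exact face_next a
    · rw [face_next, face_next]

open Classical in
theorem card_face_fiber (a : D) : Finset.card {x | T.face x = T.face a} = 3 := by
  have : ({x | T.face x = T.face a} : Finset D) = {a, T.next a, T.next (T.next a)} := by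
    ext x; simp [face_eq_face_iff_or]
  rw [this, Finset.card_eq_three]
  refine ⟨_, _, _, (T.next_ne a).symm, fun h => ?_, (T.next_ne _).symm, rfl⟩
  apply T.next_ne a
  conv_lhs => rw [h]
  exact T.next_next_next a

theorem forall_of_connected {p : D → Prop} {a : D} (ha : p a) (hrev : ∀ d, p d → p (T.rev d))
    (hnext : ∀ d, p d → p (T.next d)) (b : D) : p b := by
  obtain ⟨g, hg, rfl⟩ := T.connected a b
  have key : ∀ d, p d → p (g d) := by
    induction hg using Subgroup.closure_induction with
    | mem x hx =>
      rcases hx with rfl | rfl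
      · exact hrev
      · exact hnext
    | one => exact fun d h => h
    | mul x y _ _ hx hy => exact fun d h => hx _ (hy _ h)
    | inv x _ hx =>
      intro d h
      -- On a finite set the inverse is a positive power on each cycle.
      have hc : x.SameCycle d (x⁻¹ d) :=
        ⟨-1, by simp⟩
      exact hc.induction_on h hx
  exact key a ha

theorem sum_next {R : Type*} [AddCommMonoid R] (g : D → R) :
    ∑ d, g (T.next d) = ∑ d, g d := Equiv.sum_comp T.next g

theorem sum_rev {R : Type*} [AddCommMonoid R] (g : D → R) :
    ∑ d, g (T.rev d) = ∑ d, g d := Equiv.sum_comp T.rev g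

theorem two_mul_card_edge : 2 * Fintype.card T.Edge = Fintype.card D := by
  classical
  simpa using mul_card_filter_eq_card_filter_comp T.edge 2 card_edge_fiber T.edge_surjective
    (fun _ => True)

theorem three_mul_card_face : 3 * Fintype.card T.Face = Fintype.card D := by
  classical
  simpa using mul_card_filter_eq_card_filter_comp T.face 3 card_face_fiber T.face_surjective
    (fun _ => True)

/-- With `e = D/2` and `f = D/3`, the Euler characteristic is `v - D/6`, here negative. -/
theorem six_mul_card_vertex_lt {g : ℕ} (hg : 2 ≤ g) (hT : T.HasGenus g) :
    6 * Fintype.card T.Vertex < Fintype.card D := by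
  have hE := two_mul_card_edge (T := T)
  have hF := three_mul_card_face (T := T)
  simp only [HasGenus, eulerChar, Nat.card_eq_fintype_card] at hT
  omega

/-! ### Triangles touching a set of vertices. -/

open Classical in
/-- The oriented edges whose left face has a vertex in `B`. -/
noncomputable def touching (T : Triangulation D) (B : Finset T.Vertex) : Finset D :=
  {d | T.tail d ∈ B ∨ T.tail (T.next d) ∈ B ∨ T.tail (T.next (T.next d)) ∈ B}

open Classical in
/-- The oriented edges whose left face has its last vertex in `B` and the other two outside. -/
noncomputable def fringe (T : Triangulation D) (B : Finset T.Vertex) : Finset D :=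
  {d | T.tail d ∉ B ∧ T.tail (T.next d) ∉ B ∧ T.tail (T.next (T.next d)) ∈ B}

/-- The vertices in `B` span a connected subgraph (or `B` is empty). -/
def IsConnectedSet (T : Triangulation D) (B : Finset T.Vertex) : Prop :=
  ∀ C ⊆ B, C.Nonempty →
    (∀ d, T.tail d ∈ C → T.tail (T.next d) ∈ B → T.tail (T.next d) ∈ C) → C = B

/-- The faces with all vertices in `B`. -/
def FaceIn (T : Triangulation D) (B : Finset T.Vertex) (c : T.Face) : Prop :=
  ∀ d, T.face d = c → T.tail d ∈ B

/-- The edges with both endpoints in `B`. -/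
def EdgeIn (T : Triangulation D) (B : Finset T.Vertex) (e : T.Edge) : Prop :=
  ∀ d, T.edge d = e → T.tail d ∈ B

theorem faceIn_face {B : Finset T.Vertex} {d : D} : T.FaceIn B (T.face d) ↔
    T.tail d ∈ B ∧ T.tail (T.next d) ∈ B ∧ T.tail (T.next (T.next d)) ∈ B := by
  simp [FaceIn, face_eq_face_iff_or]

theorem edgeIn_edge {B : Finset T.Vertex} {d : D} : T.EdgeIn B (T.edge d) ↔
    T.tail d ∈ B ∧ T.tail (T.next d) ∈ B := by
  simp [EdgeIn, edge_eq_edge_iff_or, tail_rev]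

theorem sum_eq_of_forall_face {t s p a : D → ℕ}
    (h : ∀ d, t d + 2 * s d = p d + p (T.next d) + p (T.next (T.next d)) +
      (a d + a (T.next d) + a (T.next (T.next d)))) :
    ∑ d, t d + 2 * ∑ d, s d = 3 * ∑ d, p d + 3 * ∑ d, a d := by
  have hs := Finset.sum_congr (rfl : (Finset.univ : Finset D) = Finset.univ) (fun d _ => h d)
  simp only [Finset.sum_add_distrib, ← Finset.mul_sum] at hs
  have e1 := sum_next (T := T) p
  have e2 := sum_next (T := T) (fun d => p (T.next d))
  have e3 := sum_next (T := T) a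
  have e4 := sum_next (T := T) (fun d => a (T.next d))
  linarith

open Classical in
-- Face by face, with 1, 2 or 3 vertices in `B`, the identity reads `1 = 0 + 1`, `1 = 1 + 0`, `1 + 2
-- = 3 + 0`: touching plus twice full equals inner edges plus fringe edges.
theorem card_touching (B : Finset T.Vertex) :
    (T.touching B).card + 6 * Fintype.card {c // T.FaceIn B c} =
      6 * Fintype.card {e // T.EdgeIn B e} + 3 * (T.fringe B).card := by
  have hE := mul_card_filter_eq_card_filter_comp T.edge 2 card_edge_fiber T.edge_surjective
    (T.EdgeIn B)
  have hF := mul_card_filter_eq_card_filter_comp T.face 3 card_face_fiber T.face_surjective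
    (T.FaceIn B)
  rw [← Fintype.card_subtype] at hE hF
  have key := sum_eq_of_forall_face (T := T)
    (t := fun d => if d ∈ T.touching B then 1 else 0)
    (s := fun d => if T.FaceIn B (T.face d) then 1 else 0)
    (p := fun d => if T.EdgeIn B (T.edge d) then 1 else 0)
    (a := fun d => if d ∈ T.fringe B then 1 else 0) fun d => by
      simp only [touching, fringe, Finset.mem_filter, Finset.mem_univ, true_and, faceIn_face,
        edgeIn_edge, T.next_next_next]
      by_cases h0 : T.tail d ∈ B <;> by_cases h1 : T.tail (T.next d) ∈ B <;>
        by_cases h2 : T.tail (T.next (T.next d)) ∈ B <;> simp [h0, h1, h2]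
  simp only [← Finset.card_filter, Finset.filter_univ_mem] at key
  omega

/-! ### Bound on the Euler characteristic of a full subcomplex. -/

/-- The sum of the coboundary of a function on vertices and the boundary of a `2`-chain, as an
antisymmetric function on oriented edges. -/
def coboundaryAddBoundary (T : Triangulation D) :
    ((T.Vertex → ℚ) × (T.Face → ℚ)) →ₗ[ℚ] (D → ℚ) where
  toFun x d := x.1 (T.tail (T.next d)) - x.1 (T.tail d) + (x.2 (T.face d) - x.2 (T.face (T.rev d)))
  map_add' x y := by ext d; simp only [Prod.fst_add, Prod.snd_add, Pi.add_apply]; ring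
  map_smul' c x := by
    ext d
    simp only [Prod.smul_fst, Prod.smul_snd, Pi.smul_apply, smul_eq_mul, RingHom.id_apply]
    ring

theorem coboundaryAddBoundary_rev (x : (T.Vertex → ℚ) × (T.Face → ℚ)) (d : D) :
    T.coboundaryAddBoundary x (T.rev d) = -T.coboundaryAddBoundary x d := by
  simp only [coboundaryAddBoundary, LinearMap.coe_mk, AddHom.coe_mk, tail_next_rev, tail_rev,
    T.rev_rev]
  ring

/-- Coboundaries are orthogonal to boundaries. -/
theorem sum_coboundary_mul_boundary (φ : T.Vertex → ℚ) (ψ : T.Face → ℚ) :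
    ∑ d, (φ (T.tail (T.next d)) - φ (T.tail d)) * (ψ (T.face d) - ψ (T.face (T.rev d))) = 0 := by
  have h1 : ∑ d, (φ (T.tail (T.next d)) - φ (T.tail d)) * ψ (T.face d) = 0 := by
    have := sum_next (T := T) (fun d => φ (T.tail d) * ψ (T.face d))
    simp only [face_next] at this
    simp only [sub_mul, Finset.sum_sub_distrib, this, sub_self]
  have h2 : ∑ d, (φ (T.tail (T.next d)) - φ (T.tail d)) * ψ (T.face (T.rev d)) = 0 := by
    rw [← sum_rev (T := T)]
    simp only [tail_next_rev, tail_rev, T.rev_rev]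
    rw [← neg_eq_zero, ← h1, ← Finset.sum_neg_distrib]
    exact Finset.sum_congr rfl fun d _ => by ring
  simp only [mul_sub, Finset.sum_sub_distrib, h1, h2, sub_self]

/-- A Hodge argument: the coboundary of `φ` is minus the boundary of `ψ` on the edges in `B`, so
orthogonality kills the boundary. Then `ψ` is constant on the connected surface and vanishes on a
face at `w`, while `φ` is constant on the connected set `B` and vanishes at `v`. -/
theorem eq_zero_of_coboundaryAddBoundary_eq_zero {B : Finset T.Vertex} (hc : T.IsConnectedSet B)
    {v w : T.Vertex} (hv : v ∈ B) (hw : w ∉ B) {φ : T.Vertex → ℚ} {ψ : T.Face → ℚ}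
    (hφ : φ v = 0) (hψ : ∀ c, ¬ T.FaceIn B c → ψ c = 0)
    (h : ∀ d, T.EdgeIn B (T.edge d) → T.coboundaryAddBoundary (φ, ψ) d = 0) :
    (∀ u ∈ B, φ u = 0) ∧ ψ = 0 := by
  classical
  simp only [coboundaryAddBoundary, LinearMap.coe_mk, AddHom.coe_mk, edgeIn_edge] at h
  have hsupp : ∀ d, ¬ (T.tail d ∈ B ∧ T.tail (T.next d) ∈ B) → ψ (T.face d) = 0 := fun d hd =>
    hψ _ fun hf => hd ⟨(faceIn_face.1 hf).1, (faceIn_face.1 hf).2.1⟩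
  have hsq : ∀ d, (ψ (T.face d) - ψ (T.face (T.rev d))) ^ 2 =
      -((φ (T.tail (T.next d)) - φ (T.tail d)) * (ψ (T.face d) - ψ (T.face (T.rev d)))) := by
    intro d
    -- Off the edges in `B`, where `φ` is uncontrolled, both adjacent faces lie outside the support
    -- of `ψ`.
    by_cases hd : T.tail d ∈ B ∧ T.tail (T.next d) ∈ B
    · linear_combination (ψ (T.face d) - ψ (T.face (T.rev d))) * h d hd
    · have h1 := hsupp d hd
      have h2 := hsupp (T.rev d) (by rw [tail_rev, tail_next_rev]; tauto)
      rw [h1, h2]; ring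
  have hsum : ∑ d, (ψ (T.face d) - ψ (T.face (T.rev d))) ^ 2 = 0 := by
    rw [Finset.sum_congr rfl fun d _ => hsq d, Finset.sum_neg_distrib,
      sum_coboundary_mul_boundary, neg_zero]
  have hcon : ∀ d, ψ (T.face (T.rev d)) = ψ (T.face d) := by
    intro d
    have := (Finset.sum_eq_zero_iff_of_nonneg (fun d _ => sq_nonneg _)).1 hsum d (Finset.mem_univ d)
    exact (sub_eq_zero.1 (pow_eq_zero_iff two_ne_zero |>.1 this)).symm
  have hψ0 : ψ = 0 := by
    obtain ⟨a, rfl⟩ := T.tail_surjective w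
    have ha : ψ (T.face a) = 0 := hsupp a fun h => hw h.1
    funext c
    obtain ⟨b, rfl⟩ := T.face_surjective c
    exact forall_of_connected (T := T) (p := fun b => ψ (T.face b) = 0) ha
      (fun d hd => (hcon d).trans hd) (fun d hd => by rwa [face_next]) b
  refine ⟨fun u hu => ?_, hψ0⟩
  have hC := hc (B.filter fun u => φ u = 0) (Finset.filter_subset _ _)
    ⟨v, Finset.mem_filter.2 ⟨hv, hφ⟩⟩ fun d hd hd' => by
      rw [Finset.mem_filter] at hd ⊢
      refine ⟨hd', ?_⟩
      have := h d ⟨hd.1, hd'⟩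
      rw [hcon, hd.2] at this
      linarith
  rw [← hC] at hu
  exact (Finset.mem_filter.1 hu).2

open Classical in
/-- The Euler characteristic of a connected proper full subcomplex is at most one. -/
theorem card_add_card_faceIn_le {B : Finset T.Vertex} (hc : T.IsConnectedSet B)
    {v w : T.Vertex} (hv : v ∈ B) (hw : w ∉ B) :
    B.card + Fintype.card {c // T.FaceIn B c} ≤ Fintype.card {e // T.EdgeIn B e} + 1 := by
  let E₁ := Function.ExtendByZero.linearMap ℚ (Subtype.val : {u // u ∈ B} → T.Vertex)
  let E₂ := Function.ExtendByZero.linearMap ℚ (Subtype.val : {c // T.FaceIn B c} → T.Face)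
  let r : {e // T.EdgeIn B e} → D := fun e => Function.surjInv T.edge_surjective e.1
  -- The extra coordinate, the value at `v`, removes the constants and accounts for the `+ 1` in the
  -- bound.
  let L := ((LinearMap.funLeft ℚ ℚ r).comp (T.coboundaryAddBoundary.comp (E₁.prodMap E₂))).prod
    ((LinearMap.proj (⟨v, hv⟩ : {u // u ∈ B}) : ({u // u ∈ B} → ℚ) →ₗ[ℚ] ℚ).comp
      (LinearMap.fst ℚ _ ({c // T.FaceIn B c} → ℚ)))
  have hL : Function.Injective L := by
    rw [← LinearMap.ker_eq_bot, LinearMap.ker_eq_bot']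
    rintro ⟨φ, ψ⟩ h
    obtain ⟨h1, h2⟩ := Prod.ext_iff.1 h
    have hE₁ : ∀ u : {u // u ∈ B}, E₁ φ u.1 = φ u := fun u => by
      simp [E₁]
    have hE₂ : ∀ c : {c // T.FaceIn B c}, E₂ ψ c.1 = ψ c := fun c => by
      simp [E₂]
    obtain ⟨k1, k2⟩ := eq_zero_of_coboundaryAddBoundary_eq_zero hc hv hw (φ := E₁ φ) (ψ := E₂ ψ)
      ((hE₁ ⟨v, hv⟩).trans h2)
      (fun c hcB => by
        simp only [E₂, Function.ExtendByZero.linearMap_apply]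
        rw [Function.extend_apply' _ _ _ (by rintro ⟨x, rfl⟩; exact hcB x.2)]; rfl)
      (fun d hd => by
        have h3 : T.coboundaryAddBoundary (E₁ φ, E₂ ψ) (r ⟨T.edge d, hd⟩) = 0 :=
          congrFun h1 ⟨T.edge d, hd⟩
        rcases edge_eq_edge_iff_or.1 (Function.surjInv_eq T.edge_surjective (T.edge d)) with h4 | h4
        · simpa only [r, h4] using h3
        · simpa only [r, h4, coboundaryAddBoundary_rev, neg_eq_zero] using h3)
    refine Prod.ext (funext fun u => ?_) (funext fun c => ?_)
    · exact (hE₁ u).symm.trans (k1 u u.2)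
    · exact (hE₂ c).symm.trans (congrFun k2 c)
  have := LinearMap.finrank_le_finrank_of_injective hL
  simpa using this

/-! ### The walk along the fringe. -/

/-- The corner of `d` has its vertex, and the other two vertices of the triangle, outside `B`. -/
def CornerOut (B : Finset T.Vertex) (d : D) : Prop :=
  T.tail d ∉ B ∧ T.tail (T.next d) ∉ B ∧ T.tail (T.next (T.next d)) ∉ B

theorem mem_fringe {B : Finset T.Vertex} {d : D} : d ∈ T.fringe B ↔
    T.tail d ∉ B ∧ T.tail (T.next d) ∉ B ∧ T.tail (T.next (T.next d)) ∈ B := by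
  simp [fringe]

theorem tail_next_rot (d : D) : T.tail (T.next (T.rot d)) = T.tail (T.next (T.next d)) := by
  have h : T.rot d = T.rev (T.next (T.next d)) := by
    rw [← rot_next, T.next_next_next]
  rw [h, tail_next_rev]

/-- A set of oriented edges invariant under rotation contains all those with the same initial
point as one of its members. -/
theorem forall_of_rot {p : D → Prop} {a b : D} (ha : p a) (hab : T.tail a = T.tail b)
    (h : ∀ x, T.tail x = T.tail a → p x → p (T.rot x)) : p b :=
  ((tail_eq_tail_iff.1 hab).induction_on (p := fun x => T.tail x = T.tail a ∧ p x) ⟨rfl, ha⟩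
    fun x hx => ⟨(tail_rot x).trans hx.1, h x hx.1 hx.2⟩).2

/-- While rotating about the vertex, the last edge before the far endpoint enters `B` is a fringe
edge. -/
theorem exists_mem_fringe {B : Finset T.Vertex} {a b : D} (ha : T.tail a ∉ B)
    (ha' : T.tail (T.next a) ∉ B) (hab : T.tail a = T.tail b) (hb : T.tail (T.next b) ∈ B) :
    ∃ d ∈ T.fringe B, T.tail d = T.tail a := by
  by_contra! hcon
  refine forall_of_rot (p := fun x => T.tail (T.next x) ∉ B) ha' hab (fun x hx hx' hx'' => ?_) hb
  exact hcon x (mem_fringe.2 ⟨hx ▸ ha, hx', tail_next_rot (T := T) x ▸ hx''⟩) hx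

/-- In a simplicial triangulation, the walk along the edges opposite to `B` can be continued
without turning back at a vertex that has a corner in a triangle disjoint from `B`. -/
theorem IsSimplicial.exists_fringe_after (hS : T.IsSimplicial) {B : Finset T.Vertex} {e c : D}
    (he : e ∈ T.fringe B) (hc : T.CornerOut B c) (hce : T.tail c = T.tail (T.next e)) :
    ∃ d ∈ T.fringe B, T.tail d = T.tail (T.next e) ∧ T.tail (T.next d) ≠ T.tail e := by
  obtain ⟨he0, he1, he2⟩ := mem_fringe.1 he
  by_contra! hcon
  have hloop : ∀ x, T.tail (T.next x) ≠ T.tail x := fun x hx =>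
    hS.1 x (by rw [head, tail_rev, hx])
  have hpar : ∀ x y, T.tail x = T.tail y → T.tail (T.next x) = T.tail (T.next y) → x = y :=
    fun x y h1 h2 => hS.2 x y h1 (by rw [head, head, tail_rev, tail_rev, h2])
  have hrevt : T.tail (T.rev e) = T.tail (T.next e) := tail_rev e
  -- Rotation from `a` never enters `B`: the edge just before entry would be a fringe edge, hence
  -- `T.rev e` by `hcon` and the absence of parallel edges. Nor does it reach `T.rev e`, whose
  -- predecessor `T.next e` ends in `B`. Yet `T.rev e` lies on this cycle.
  have key : ∀ a, T.tail a = T.tail (T.next e) → T.tail (T.next a) ∉ B → a ≠ T.rev e → False := by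
    intro a ha ha' hae
    refine (forall_of_rot (T := T) (p := fun x => T.tail (T.next x) ∉ B ∧ x ≠ T.rev e)
      ⟨ha', hae⟩ (ha.trans hrevt.symm) fun x hx hx' => ⟨fun hxB => ?_, fun hxe => ?_⟩).2 rfl
    · rw [ha] at hx
      refine hx'.2 (hpar _ _ (hx.trans hrevt.symm) ?_)
      rw [tail_next_rev]
      exact hcon x (mem_fringe.2 ⟨hx ▸ he1, hx'.1, tail_next_rot (T := T) x ▸ hxB⟩) hx
    · rw [← rot_next] at hxe
      rw [T.rot.injective hxe] at hx'
      exact hx'.1 he2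
  -- If the free corner starts at `T.rev e`, the other side of that corner serves instead; the two
  -- differ as there are no loops.
  by_cases hce' : c = T.rev e
  · refine key (T.rot c) ((tail_rot c).trans hce) ?_ fun h => ?_
    · rw [tail_next_rot]; exact hc.2.2
    · refine hloop (T.next c) ?_
      rw [← tail_next_rot, h, hce']
  · exact key c hce hc.2.1 hce'

theorem exists_tail_notMem_of_ne_univ {B : Finset T.Vertex} {v w : T.Vertex} (hv : v ∈ B)
    (hw : w ∉ B) : ∃ d, T.tail d ∉ B ∧ T.tail (T.next d) ∈ B := by
  by_contra! hcon
  obtain ⟨a, rfl⟩ := T.tail_surjective v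
  obtain ⟨b, rfl⟩ := T.tail_surjective w
  refine forall_of_connected (T := T) (p := fun d => T.tail d ∉ B ∧ T.tail (T.next d) ∉ B)
    ⟨hw, hcon b hw⟩ (fun d hd => ?_) (fun d hd => ?_) a |>.1 hv
  · rw [tail_rev, tail_next_rev]; exact hd.symm
  · exact ⟨hd.2, hcon _ hd.2⟩

/-- Three successive steps of the walk are distinct: neighbours because there are no loops, first
and third because it does not turn back. -/
theorem IsSimplicial.three_le_card_fringe (hS : T.IsSimplicial) {B : Finset T.Vertex}
    {v w : T.Vertex} (hv : v ∈ B) (hw : w ∉ B)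
    (h : ∀ a, T.tail a ∉ B → T.tail (T.next a) ∈ B → ∃ c, T.tail c = T.tail a ∧ T.CornerOut B c) :
    3 ≤ (T.fringe B).card := by
  classical
  have hstep : ∀ e ∈ T.fringe B,
      ∃ d ∈ T.fringe B, T.tail d = T.tail (T.next e) ∧ T.tail (T.next d) ≠ T.tail e := by
    intro e he
    obtain ⟨-, he1, he2⟩ := mem_fringe.1 he
    obtain ⟨c, hc, hc'⟩ := h (T.next e) he1 he2
    exact hS.exists_fringe_after he hc' hc
  have hloop : ∀ x, T.tail (T.next x) ≠ T.tail x := fun x hx =>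
    hS.1 x (by rw [head, tail_rev, hx])
  obtain ⟨a, ha, ha'⟩ := exists_tail_notMem_of_ne_univ hv hw
  obtain ⟨c, hc, hc'⟩ := h a ha ha'
  obtain ⟨e₀, h₀, -⟩ := exists_mem_fringe hc'.1 hc'.2.1 hc ha'
  obtain ⟨e₁, h₁, t₁, n₁⟩ := hstep e₀ h₀
  obtain ⟨e₂, h₂, t₂, n₂⟩ := hstep e₁ h₁
  have h01 : e₀ ≠ e₁ := fun h => hloop e₀ (by rw [← t₁, h])
  have h12 : e₁ ≠ e₂ := fun h => hloop e₁ (by rw [← t₂, h])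
  have h02 : e₀ ≠ e₂ := fun h => n₁ (by rw [← t₂, h])
  rw [← Finset.card_eq_three.2 ⟨e₀, e₁, e₂, h01, h02, h12, rfl⟩]
  refine Finset.card_le_card fun x hx => ?_
  simp only [Finset.mem_insert, Finset.mem_singleton] at hx
  rcases hx with rfl | rfl | rfl <;> assumption

/-! ### Nonempty sets touch many triangles. -/

open Classical in
theorem touching_insert_subset {B : Finset T.Vertex} {w : T.Vertex}
    (h : ∀ c, T.tail c = w → ¬ T.CornerOut B c) : T.touching (insert w B) ⊆ T.touching B := by
  intro d hd
  simp only [touching, Finset.mem_filter, Finset.mem_univ, true_and, Finset.mem_insert] at hd ⊢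
  by_contra hB
  push Not at hB
  obtain ⟨h0, h1, h2⟩ := hB
  have h3 := T.next_next_next d
  rcases hd with (hd | hd) | (hd | hd) | (hd | hd)
  · exact h d hd ⟨h0, h1, h2⟩
  · exact h0 hd
  · exact h _ hd ⟨h1, h2, h3.symm ▸ h0⟩
  · exact h1 hd
  · exact h _ hd ⟨h2, h3.symm ▸ h0, h3.symm ▸ h1⟩
  · exact h2 hd

theorem touching_mono {B C : Finset T.Vertex} (h : C ⊆ B) : T.touching C ⊆ T.touching B := by
  intro d hd
  simp only [touching, Finset.mem_filter, Finset.mem_univ, true_and] at hd ⊢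
  exact hd.imp (@h _) (Or.imp (@h _) (@h _))

open Classical in
theorem IsConnectedSet.insert {B : Finset T.Vertex} (hB : T.IsConnectedSet B) {a : D}
    (ha' : T.tail (T.next a) ∈ B) :
    T.IsConnectedSet (insert (T.tail a) B) := by
  intro C hC hne hcl
  by_cases hCB : (C ∩ B).Nonempty
  · have h1 := hB (C ∩ B) Finset.inter_subset_right hCB fun d hd hd' => by
      rw [Finset.mem_inter] at hd ⊢
      exact ⟨hcl d hd.1 (Finset.mem_insert_of_mem hd'), hd'⟩
    have h2 : B ⊆ C := h1 ▸ Finset.inter_subset_left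
    refine hC.antisymm (Finset.insert_subset ?_ h2)
    have := hcl (T.rev a) (by rw [tail_rev]; exact h2 ha')
    rw [tail_next_rev] at this
    exact this (Finset.mem_insert_self _ _)
  · rw [Finset.not_nonempty_iff_eq_empty, Finset.eq_empty_iff_forall_notMem] at hCB
    obtain ⟨x, hx⟩ := hne
    have hxa : x = T.tail a := (Finset.mem_insert.1 (hC hx)).resolve_right fun h =>
      hCB x (Finset.mem_inter.2 ⟨hx, h⟩)
    have := hcl a (hxa ▸ hx) (Finset.mem_insert_of_mem ha')
    exact (hCB _ (Finset.mem_inter.2 ⟨this, ha'⟩)).elim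

theorem IsSimplicial.six_mul_card_lt_of_isConnectedSet (hS : T.IsSimplicial)
    (hV : 6 * Fintype.card T.Vertex < Fintype.card D) (n : ℕ) (B : Finset T.Vertex)
    (hn : Fintype.card T.Vertex = B.card + n) (hne : B.Nonempty) (hB : T.IsConnectedSet B) :
    6 * B.card < (T.touching B).card := by
  classical
  induction n generalizing B with
  | zero =>
    have hBu : B = Finset.univ := (Finset.card_eq_iff_eq_univ B).1 hn.symm
    have ht : T.touching B = Finset.univ := by simp [touching, hBu]
    rw [ht, hBu, Finset.card_univ, Finset.card_univ]
    exact hV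
  | succ n ih =>
    obtain ⟨v, hv⟩ := hne
    obtain ⟨w, hw⟩ : ∃ w, w ∉ B := by
      by_contra! hcon
      rw [← Finset.eq_univ_iff_forall, ← Finset.card_eq_iff_eq_univ] at hcon
      omega
    by_cases h : ∀ a, T.tail a ∉ B → T.tail (T.next a) ∈ B →
        ∃ c, T.tail c = T.tail a ∧ T.CornerOut B c
    -- The count gives `6(E - F) + 3 * 3 ≥ 6(|B| - 1) + 9 > 6|B|`, with `E`, `F` the numbers of
    -- edges and faces in `B`.
    · have h1 := hS.three_le_card_fringe hv hw h
      have h2 := card_add_card_faceIn_le hB hv hw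
      have h3 := card_touching (T := T) B
      omega
    · push Not at h
      obtain ⟨a, ha, ha', hac⟩ := h
      have hcard := Finset.card_insert_of_notMem ha
      have h1 := ih (insert (T.tail a) B) (by omega) (Finset.insert_nonempty _ _) (hB.insert ha')
      have h2 := Finset.card_le_card (touching_insert_subset hac)
      omega

/-- In a simplicial triangulation of negative Euler characteristic, every nonempty set of vertices
meets more than twice as many faces as it has elements. -/
theorem IsSimplicial.six_mul_card_lt (hS : T.IsSimplicial)
    (hV : 6 * Fintype.card T.Vertex < Fintype.card D) (B : Finset T.Vertex) (hne : B.Nonempty) :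
    6 * B.card < (T.touching B).card := by
  classical
  induction B using Finset.strongInduction with
  | H B ih =>
  by_cases hB : T.IsConnectedSet B
  · have := Finset.card_le_univ B
    exact hS.six_mul_card_lt_of_isConnectedSet hV (Fintype.card T.Vertex - B.card) B
      (by omega) hne hB
  simp only [IsConnectedSet, not_forall] at hB
  obtain ⟨C, hCB, hC, hcl, hCne⟩ := hB
  have hss : C ⊂ B := hCB.ssubset_of_ne hCne
  have h1 := ih C hss hC
  have h2 := ih (B \ C) (Finset.sdiff_ssubset hCB hC) (Finset.sdiff_nonempty.2 hss.2)
  have hnext : ∀ d, T.tail d ∈ C → T.tail (T.next d) ∉ B \ C := fun d h h' =>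
    (Finset.mem_sdiff.1 h').2 (hcl d h (Finset.mem_sdiff.1 h').1)
  have hprev : ∀ d, T.tail (T.next d) ∈ C → T.tail d ∉ B \ C := fun d h => by
    have := hnext (T.rev d) (by rwa [tail_rev])
    rwa [tail_next_rev] at this
  have hself : ∀ d, T.tail d ∈ C → T.tail d ∉ B \ C := fun d h h' => (Finset.mem_sdiff.1 h').2 h
  -- Any two vertices of a triangle are equal or adjacent, and no edge joins `C` to `B \ C`.
  have hdis : Disjoint (T.touching C) (T.touching (B \ C)) := by
    rw [Finset.disjoint_left]
    intro d hd hd'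
    simp only [touching, Finset.mem_filter, Finset.mem_univ, true_and] at hd hd'
    have h3 := T.next_next_next d
    rcases hd with hd | hd | hd <;> rcases hd' with hd' | hd' | hd'
    · exact hself _ hd hd'
    · exact hnext _ hd hd'
    · exact hprev _ (h3.symm ▸ hd) hd'
    · exact hprev _ hd hd'
    · exact hself _ hd hd'
    · exact hnext _ hd hd'
    · exact hnext _ hd (h3.symm ▸ hd')
    · exact hprev _ hd hd'
    · exact hself _ hd hd'
  have hsub := Finset.union_subset (touching_mono hCB) (touching_mono (T := T) (B := B)
    (C := B \ C) Finset.sdiff_subset)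
  have h3 := Finset.card_le_card hsub
  rw [Finset.card_union_of_disjoint hdis] at h3
  have h4 := Finset.card_sdiff_add_card_eq_card hCB
  omega

/-! ### Decorations -/

namespace Decoration

variable (δ : Decoration T)

theorem inversion_nonneg (d : D) : 0 ≤ δ.inversion d := by
  unfold inversion
  dsimp only
  split_ifs <;> norm_num

theorem edgeOriented_rev {d : D} : δ.EdgeOriented (T.rev d) ↔ δ.EdgeOriented d := by
  rw [EdgeOriented, EdgeOriented, T.rev_rev, or_comm]

theorem tail_mem_of_edgeOriented {d : D} (h : δ.EdgeOriented d) : T.tail d ∈ δ.blue := by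
  rcases h with h | h
  · exact (δ.blue_of_mem d h).1
  · have := (δ.blue_of_mem _ h).2
    rwa [head, T.rev_rev] at this

theorem tail_next_mem_of_edgeOriented {d : D} (h : δ.EdgeOriented d) :
    T.tail (T.next d) ∈ δ.blue := by
  rw [← tail_rev]
  exact δ.tail_mem_of_edgeOriented (δ.edgeOriented_rev.2 h)

theorem inversion_eq_zero {d : D} (h : T.tail d ∉ δ.blue) : δ.inversion d = 0 := by
  have h1 : ¬ δ.EdgeOriented d := fun hd => h (δ.tail_mem_of_edgeOriented hd)
  have h2 : ¬ δ.EdgeOriented (T.next.symm d) := fun hd => h (by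
    simpa using δ.tail_next_mem_of_edgeOriented hd)
  simp [inversion, h, h1, h2]

theorem edge_cases (d : D) :
    (d ∈ δ.arrows ∧ T.rev d ∉ δ.arrows ∧ T.tail d ∈ δ.blue ∧ T.tail (T.next d) ∈ δ.blue) ∨
    (d ∉ δ.arrows ∧ T.rev d ∈ δ.arrows ∧ T.tail d ∈ δ.blue ∧ T.tail (T.next d) ∈ δ.blue) ∨
    (d ∉ δ.arrows ∧ T.rev d ∉ δ.arrows) := by
  by_cases h : d ∈ δ.arrows
  · exact Or.inl ⟨h, δ.rev_notMem d h, δ.tail_mem_of_edgeOriented (Or.inl h),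
      δ.tail_next_mem_of_edgeOriented (Or.inl h)⟩
  by_cases h' : T.rev d ∈ δ.arrows
  · exact Or.inr (Or.inl ⟨h, h', δ.tail_mem_of_edgeOriented (Or.inr h'),
      δ.tail_next_mem_of_edgeOriented (Or.inr h')⟩)
  · exact Or.inr (Or.inr ⟨h, h'⟩)

open Classical in
theorem inversion_next (d : D) : δ.inversion (T.next d) =
    if T.tail (T.next d) ∈ δ.blue ∧ ((¬ δ.EdgeOriented d ∧ ¬ δ.EdgeOriented (T.next d)) ∨
      (d ∈ δ.arrows ∧ T.next d ∈ δ.arrows) ∨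
      (T.rev d ∈ δ.arrows ∧ T.rev (T.next d) ∈ δ.arrows)) then 1
    else if (δ.EdgeOriented d ∧ ¬ δ.EdgeOriented (T.next d)) ∨
      (¬ δ.EdgeOriented d ∧ δ.EdgeOriented (T.next d)) then 1 / 2
    else 0 := by
  simp only [inversion, Equiv.symm_apply_apply]

/-- The inversions of the corners of a triangle with a blue vertex add up to at least one. -/
theorem one_le_inversion_add {d : D} (h : T.tail d ∈ δ.blue ∨ T.tail (T.next d) ∈ δ.blue ∨
    T.tail (T.next (T.next d)) ∈ δ.blue) :
    1 ≤ δ.inversion d + δ.inversion (T.next d) + δ.inversion (T.next (T.next d)) := by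
  have i0 := δ.inversion_next (T.next (T.next d))
  rw [T.next_next_next] at i0
  have o0 := δ.edge_cases d
  have o1 := δ.edge_cases (T.next d)
  have o2 := δ.edge_cases (T.next (T.next d))
  rw [T.next_next_next] at o2
  rw [i0, inversion_next, inversion_next]
  clear i0
  simp only [EdgeOriented]
  -- With no oriented side, a blue corner gives 1. With one or two, exactly two corners have one
  -- oriented side and give 1/2 each. With three, two sides agree relative to the boundary direction
  -- and their corner gives 1.
  by_cases b0 : T.tail d ∈ δ.blue <;> by_cases b1 : T.tail (T.next d) ∈ δ.blue <;>
    by_cases b2 : T.tail (T.next (T.next d)) ∈ δ.blue <;>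
    rcases o0 with o0 | o0 | o0 <;> rcases o1 with o1 | o1 | o1 <;>
    rcases o2 with o2 | o2 | o2 <;> simp_all <;> norm_num

open Classical in
-- Summing the triangle inequality over oriented edges counts each corner three times, and the
-- corners contribute at most 2 per blue vertex and 0 at white ones.
theorem IsTight.card_touching_le {δ : Decoration T} (hδ : δ.IsTight) :
    (T.touching {v | v ∈ δ.blue}).card ≤ 6 * Finset.card {v | v ∈ δ.blue} := by
  have h1 : ∑ d, δ.inversion d ≤ 2 * (Finset.card {v | v ∈ δ.blue} : ℚ) := by
    rw [← Finset.sum_fiberwise Finset.univ T.tail, mul_comm, ← nsmul_eq_mul,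
      ← Finset.sum_filter_add_sum_filter_not Finset.univ (· ∈ δ.blue)]
    rw [Finset.sum_eq_zero (s := Finset.filter (· ∉ δ.blue) _), add_zero]
    · exact Finset.sum_le_card_nsmul _ _ _ fun v hv => hδ v (Finset.mem_filter.1 hv).2
    · intro v hv
      refine Finset.sum_eq_zero fun d hd => δ.inversion_eq_zero ?_
      rw [(Finset.mem_filter.1 hd).2]
      exact (Finset.mem_filter.1 hv).2
  have h2 : ((T.touching {v | v ∈ δ.blue}).card : ℚ) ≤
      ∑ d, (δ.inversion d + δ.inversion (T.next d) + δ.inversion (T.next (T.next d))) := by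
    rw [← nsmul_one]
    refine (Finset.card_nsmul_le_sum _ _ _ fun d hd => ?_).trans
      (Finset.sum_le_sum_of_subset_of_nonneg (Finset.subset_univ _) fun d _ _ =>
        add_nonneg (add_nonneg (δ.inversion_nonneg _) (δ.inversion_nonneg _))
          (δ.inversion_nonneg _))
    exact δ.one_le_inversion_add (by simpa [touching] using hd)
  have h3 := sum_next (T := T) δ.inversion
  have h4 := sum_next (T := T) fun d => δ.inversion (T.next d)
  simp only [Finset.sum_add_distrib] at h2
  have : ((T.touching {v | v ∈ δ.blue}).card : ℚ) ≤ 6 * (Finset.card {v | v ∈ δ.blue} : ℚ) := by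
    linarith
  exact_mod_cast this

theorem eq_trivial_of_blue_eq_empty {δ : Decoration T} (h : δ.blue = ∅) : δ = trivial T :=
  Decoration.ext h <| Set.eq_empty_of_forall_notMem fun d hd =>
    Set.notMem_empty _ (h ▸ (δ.blue_of_mem d hd).1)

end Decoration

open Classical in
/-- In a simplicial triangulation of negative Euler characteristic, every tight decoration is
white. -/
theorem IsSimplicial.blue_eq_empty (hS : T.IsSimplicial)
    (hV : 6 * Fintype.card T.Vertex < Fintype.card D) {δ : Decoration T} (hδ : δ.IsTight) :
    δ.blue = ∅ := by
  by_contra hne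
  obtain ⟨v, hv⟩ := Set.nonempty_iff_ne_empty.2 hne
  have h1 := hδ.card_touching_le
  have h2 := hS.six_mul_card_lt hV {v | v ∈ δ.blue} ⟨v, by simpa using hv⟩
  omega

/-! ### Coverings -/

namespace IsCovering

variable {D' : Type u} [Fintype D'] {T' : Triangulation D'} {f : D' → D}

theorem tail_eq (hf : IsCovering T' T f) {a b : D'} (h : T'.tail a = T'.tail b) :
    T.tail (f a) = T.tail (f b) := (hf.bijOn_star b).mapsTo h

/-- The map of vertices underlying a covering. -/
def vertexMap (hf : IsCovering T' T f) : T'.Vertex → T.Vertex :=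
  Quotient.lift (fun d => T.tail (f d)) fun _ _ h => hf.tail_eq (Quotient.sound h)

theorem vertexMap_tail (hf : IsCovering T' T f) (d : D') :
    hf.vertexMap (T'.tail d) = T.tail (f d) := rfl

/-- The lift of a decoration to a covering. -/
def lift (hf : IsCovering T' T f) (δ : Decoration T) : Decoration T' where
  blue := hf.vertexMap ⁻¹' δ.blue
  arrows := f ⁻¹' δ.arrows
  rev_notMem d hd h := δ.rev_notMem _ hd (by rwa [Set.mem_preimage, hf.map_rev] at h)
  blue_of_mem d hd := by
    have := δ.blue_of_mem _ hd
    simpa only [Set.mem_preimage, head, vertexMap_tail, hf.map_rev] using this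

theorem map_next_symm (hf : IsCovering T' T f) (d : D') :
    f (T'.next.symm d) = T.next.symm (f d) := by
  rw [Equiv.eq_symm_apply, ← hf.map_next, Equiv.apply_symm_apply]

open Classical in
theorem inversion_lift (hf : IsCovering T' T f) (δ : Decoration T) (d : D') :
    (hf.lift δ).inversion d = δ.inversion (f d) := by
  refine if_congr ?_ rfl (if_congr ?_ rfl rfl) <;>
    simp only [Decoration.EdgeOriented, lift, Set.mem_preimage, hf.map_rev, hf.map_next_symm,
      vertexMap_tail]

open Classical in
theorem sum_star (hf : IsCovering T' T f) (a : D') (g : D → ℚ) :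
    ∑ d with T'.tail d = T'.tail a, g (f d) = ∑ d with T.tail d = T.tail (f a), g d := by
  have h := hf.bijOn_star a
  refine Finset.sum_bij (fun d _ => f d) (fun d hd => ?_) (fun d hd d' hd' hdd => ?_)
    (fun d hd => ?_) (fun _ _ => rfl)
  · simpa using h.mapsTo (by simpa using hd)
  · exact h.injOn (by simpa using hd) (by simpa using hd') hdd
  · obtain ⟨x, hx, rfl⟩ := h.surjOn (by simpa using hd)
    exact ⟨x, by simpa using hx, rfl⟩

theorem isTight_lift (hf : IsCovering T' T f) {δ : Decoration T} (hδ : δ.IsTight) :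
    (hf.lift δ).IsTight := by
  intro v hv
  obtain ⟨a, rfl⟩ := T'.tail_surjective v
  simp only [Decoration.totalInversion, hf.inversion_lift]
  rw [hf.sum_star a δ.inversion]
  exact hδ _ hv

open Classical in
/-- All fibres of a covering have the same number of elements. -/
theorem exists_card_fiber (hf : IsCovering T' T f) :
    ∃ n : ℕ, 0 < n ∧ ∀ d, Finset.card {x | f x = d} = n := by
  obtain ⟨a⟩ := T.nonempty
  refine ⟨Finset.card {x | f x = a}, ?_, fun d => ?_⟩
  · obtain ⟨x, hx⟩ := hf.surjective a
    exact Finset.card_pos.2 ⟨x, by simpa using hx⟩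
  · refine forall_of_connected (T := T)
      (p := fun d => Finset.card {x | f x = d} = Finset.card {x | f x = a}) rfl
      (fun d hd => ?_) (fun d hd => ?_) d
    · rw [← hd]
      exact (Finset.card_equiv T'.rev fun x => by simp [hf.map_rev]).symm
    · rw [← hd]
      exact (Finset.card_equiv T'.next fun x => by simp [hf.map_next]).symm

open Classical in
-- Writes the number of vertices as a sum over oriented edges of a quantity preserved by coverings,
-- so that it scales with the degree.
theorem sum_inv_card_star (T : Triangulation D) :
    ∑ d, ((Finset.card {x | T.tail x = T.tail d} : ℚ))⁻¹ = Fintype.card T.Vertex := by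
  rw [← Finset.sum_fiberwise Finset.univ T.tail, ← Finset.card_univ, Finset.card_eq_sum_ones,
    Nat.cast_sum]
  refine Finset.sum_congr rfl fun v _ => ?_
  obtain ⟨a, rfl⟩ := T.tail_surjective v
  rw [Finset.sum_congr rfl (g := fun _ => (Finset.card {x | T.tail x = T.tail a} : ℚ)⁻¹)
    fun d hd => by rw [(Finset.mem_filter.1 hd).2], Finset.sum_const, nsmul_eq_mul,
    Nat.cast_one, mul_inv_cancel₀]
  exact_mod_cast (Finset.card_pos.2 ⟨a, by simp⟩).ne'

theorem six_mul_card_vertex_lt (hf : IsCovering T' T f)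
    (hV : 6 * Fintype.card T.Vertex < Fintype.card D) :
    6 * Fintype.card T'.Vertex < Fintype.card D' := by
  classical
  obtain ⟨n, hn, hcard⟩ := hf.exists_card_fiber
  have hsum : ∀ g : D → ℚ, ∑ d, g (f d) = n * ∑ d, g d := fun g => by
    rw [← Finset.sum_fiberwise Finset.univ f, Finset.mul_sum]
    refine Finset.sum_congr rfl fun d _ => ?_
    rw [Finset.sum_congr rfl (g := fun _ => g d) fun x hx => by rw [(Finset.mem_filter.1 hx).2],
      Finset.sum_const, hcard, nsmul_eq_mul]
  have hD : (Fintype.card D' : ℚ) = n * Fintype.card D := by simpa using hsum fun _ => 1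
  have hstar : ∀ d, (Finset.card {x | T'.tail x = T'.tail d} : ℚ) =
      Finset.card {x | T.tail x = T.tail (f d)} := fun d => by
    simpa using hf.sum_star d fun _ => 1
  have hVert : (Fintype.card T'.Vertex : ℚ) = n * Fintype.card T.Vertex := by
    rw [← sum_inv_card_star, ← sum_inv_card_star, ← hsum]
    exact Finset.sum_congr rfl fun d _ => by rw [hstar]
  have hV' : (6 * Fintype.card T.Vertex : ℚ) < Fintype.card D := by exact_mod_cast hV
  have : (6 * Fintype.card T'.Vertex : ℚ) < Fintype.card D' := by
    rw [hVert, hD, mul_left_comm]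
    exact mul_lt_mul_of_pos_left hV' (by exact_mod_cast hn)
  exact_mod_cast this

end IsCovering

end Triangulation

theorem mainTheorem3 {D : Type u} [Fintype D] (T : Triangulation D) (g : ℕ) (hg : 2 ≤ g)
    (hT : T.HasGenus g) (hq : T.IsQuasiSimplicial) (δ : Triangulation.Decoration T) :
    δ.IsTight ↔ δ = Triangulation.Decoration.trivial T := by
  constructor
  · intro hδ
    obtain ⟨D', _, T', f, hf, hS⟩ := hq
    have hblue := hS.blue_eq_empty
      (hf.six_mul_card_vertex_lt (Triangulation.six_mul_card_vertex_lt hg hT)) (hf.isTight_lift hδ)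
    refine Triangulation.Decoration.eq_trivial_of_blue_eq_empty
      (Set.eq_empty_of_forall_notMem fun v hv => ?_)
    obtain ⟨d, rfl⟩ := T.tail_surjective v
    obtain ⟨x, rfl⟩ := hf.surjective d
    have : T'.tail x ∈ (hf.lift δ).blue := hv
    rw [hblue] at this
    exact this
  · rintro rfl v hv
    exact hv.elim
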